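/- Let $m\ge 2$. Let $\mathcal C(\mathbb Z_m)\subseteq\mathbb R_{\ge 0}^{m-1}$, with coordinates indexed by the nonzero elements of $\mathbb Z_m$, be the cone of all nonnegative $x$ satisfying $x_i+x_j\ge x_{i+j}$ for all nonzero $i,j\in\mathbb Z_m$ with $i+j\neq 0$, and let the Kunz polyhedron $P_m$ be its translate with vertex $v=(-\tfrac1m,\dots,-\tfrac{m-1}m)$. Let $F$ be a nonempty face of $P_m$ and write $F'=F-v$, a face of $\mathcal C(\mathbb Z_m)$. Put $x_0=0$, and let $H=\{h\in\mathbb Z_m: x_h=0\text{ for all }x\in F'\}$, which is a subgroup. The points of $F'$ are constant on cosets of $H$. The Kunz poset of $F$ is $P=(\mathbb Z_m/H,\preceq)$, where $\overline a\preceq\overline b$ if and only if $x_a+x_{b-a}=x_b$ for all $x\in F'$ (so $P$ is a poset on $\mathbb Z_m$ when $H=0$). Let $p_1,\dots,p_k$ be the atoms of $P$, that is, the elements covering the minimal element $\overline 0$. Let $N=P\cup\{\infty\}$ be the commutative monoid in which $\infty$ is absorbing and $\overline a\oplus\overline b$ equals $\overline{a+b}$ if $x_a+x_b=x_{a+b}$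 for all $x\in F'$, and $\infty$ otherwise. Let $\varphi_P:\mathbb N^k\to N$ be the homomorphism $z\mapsto z_1p_1\oplus\cdots\oplus z_kp_k$. A presentation of $P$ is a set $\rho\subseteq\mathbb N^k\times\mathbb N^k$ obtained from a generating set of the congruence $\ker\varphi_P$ by omitting all generators $(z,z')$ with $\varphi_P(z)=\infty$. For finite $\rho$, let $M_\rho\in\mathbb Z^{|\rho|\times k}$ be the matrix whose rows are $z-z'$ for $(z,z')\in\rho$. Theorem. For every face $F$ of $P_m$ with Kunz poset $P$, and every finite presentation $\rho$ of $P$, $$\dim F = k-\operatorname{rk}(M_\rho),$$ where $k$ is the number of atoms of $P$ and $\dim F$ is the dimension of the affine span of $F$. -/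

import Mathlib

noncomputable section

/-- The `g`-th coordinate of a point of `ℝ^(G ∖ {0})`, with the usual convention `x_0 = 0`. -/
def coord {G : Type*} [AddCommGroup G] (x : {g : G // g ≠ 0} → ℝ) (g : G) : ℝ :=
  open Classical in if h : g = 0 then 0 else x ⟨g, h⟩

/-- The group cone `C(G) ⊆ ℝ_{≥0}^(G ∖ {0})`: all nonnegative `x` with `x_i + x_j ≥ x_{i+j}`
for nonzero `i, j` with `i + j ≠ 0`. -/
def groupCone (G : Type*) [AddCommGroup G] : Set ({g : G // g ≠ 0} → ℝ) :=
  {x | (∀ i, 0 ≤ x i) ∧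
    ∀ (i j : {g : G // g ≠ 0}) (h : i.1 + j.1 ≠ 0), x ⟨i.1 + j.1, h⟩ ≤ x i + x j}

/-- The point `(-1/m, …, -(m-1)/m)`; coordinates are indexed by the nonzero elements of `ℤ/m`. -/
def kunzVertex (m : ℕ) : {a : ZMod m // a ≠ 0} → ℝ := fun i => -((i.1.val : ℝ) / (m : ℝ))

/-- The Kunz polyhedron `P_m`: the translate of `C(ℤ/m)` with vertex `kunzVertex m`. -/
def kunzPolyhedron (m : ℕ) : Set ({a : ZMod m // a ≠ 0} → ℝ) :=
  {x | x - kunzVertex m ∈ groupCone (ZMod m)}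

/-- `F` is a (nonempty) face of the polyhedron `P`: the set of maximizers over `P` of some
linear functional. The zero functional gives `P` itself. -/
def IsPolyhedronFace {E : Type*} [AddCommGroup E] [TopologicalSpace E] [Module ℝ E]
    (P F : Set E) : Prop :=
  F.Nonempty ∧ IsExposed ℝ P F

/-- The dimension of a face: the dimension of its affine span. -/
def faceDim {E : Type*} [AddCommGroup E] [Module ℝ E] (F : Set E) : ℕ :=
  Module.finrank ℝ (affineSpan ℝ F).direction

/-- A face of the group cone `C(G)`. -/
structure GroupConeFace (G : Type*) [AddCommGroup G] where
  carrier : Set ({g : G // g ≠ 0} → ℝ)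
  isFace : IsPolyhedronFace (groupCone G) carrier

theorem coord_zero {G : Type*} [AddCommGroup G] (x : {g : G // g ≠ 0} → ℝ) :
    coord x 0 = 0 := by
  simp [coord]

theorem coord_coe {G : Type*} [AddCommGroup G] (x : {g : G // g ≠ 0} → ℝ)
    (g : {g : G // g ≠ 0}) : coord x g.1 = x g := by
  simp [coord, g.2]

theorem coord_nonneg {G : Type*} [AddCommGroup G] {x : {g : G // g ≠ 0} → ℝ}
    (hx : x ∈ groupCone G) (a : G) : 0 ≤ coord x a := by
  unfold coord
  split_ifs with h
  · exact le_rfl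
  · exact hx.1 _

theorem coord_add_le {G : Type*} [AddCommGroup G] {x : {g : G // g ≠ 0} → ℝ}
    (hx : x ∈ groupCone G) (a b : G) : coord x (a + b) ≤ coord x a + coord x b := by
  by_cases ha : a = 0
  · subst ha; simp [coord_zero]
  by_cases hb : b = 0
  · subst hb; simp [coord_zero]
  by_cases hab : a + b = 0
  · rw [hab, coord_zero]
    exact add_nonneg (coord_nonneg hx a) (coord_nonneg hx b)
  · have := hx.2 ⟨a, ha⟩ ⟨b, hb⟩ hab
    simpa [coord, ha, hb, hab] using this

theorem GroupConeFace.mem_groupCone {G : Type*} [AddCommGroup G] (F : GroupConeFace G)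
    {x : {g : G // g ≠ 0} → ℝ} (hx : x ∈ F.carrier) : x ∈ groupCone G :=
  F.isFace.2.subset hx

/-- The face `F - v` of `C(ℤ/m)` corresponding to the face `F` of `P_m`,
where `v = kunzVertex m`. -/
def GroupConeFace.ofKunz {m : ℕ} (F : Set ({a : ZMod m // a ≠ 0} → ℝ))
    (hF : IsPolyhedronFace (kunzPolyhedron m) F) : GroupConeFace (ZMod m) where
  carrier := {y | y + kunzVertex m ∈ F}
  isFace := by
    obtain ⟨⟨x, hx⟩, hexp⟩ := hF
    obtain ⟨l, hl⟩ := hexp ⟨x, hx⟩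
    refine ⟨⟨x - kunzVertex m, by simpa using hx⟩, fun _ => ⟨l, ?_⟩⟩
    ext y
    rw [hl]
    simp only [kunzPolyhedron, Set.mem_ofPred_eq, add_sub_cancel_right, map_add]
    refine and_congr_right fun _ => ⟨fun h z hz => ?_, fun h z hz => ?_⟩
    · have := h (z + kunzVertex m) (by simpa using hz)
      rw [map_add] at this
      linarith
    · have := h (z - kunzVertex m) hz
      rw [map_sub] at this
      linarith

/-- The Kunz subgroup `H = {h : x_h = 0 for all x ∈ F}` of a face `F` of `C(G)`. -/
def GroupConeFace.kunzSubgroup {G : Type*} [AddCommGroup G] [Finite G]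
    (F : GroupConeFace G) : AddSubgroup G :=
  let M : AddSubmonoid G :=
    { carrier := {h | ∀ x ∈ F.carrier, coord x h = 0}
      zero_mem' := fun x _ => coord_zero x
      add_mem' := by
        intro a b ha hb x hx
        have h1 := coord_add_le (F.mem_groupCone hx) a b
        rw [ha x hx, hb x hx, add_zero] at h1
        exact le_antisymm h1 (coord_nonneg (F.mem_groupCone hx) _) }
  { M with
    neg_mem' := by
      intro a ha
      have h1 : -a = (addOrderOf a - 1) • a := by
        have h2 : (addOrderOf a - 1) • a + a = 0 := by
          rw [← succ_nsmul, Nat.sub_add_cancel (addOrderOf_pos a), addOrderOf_nsmul_eq_zero]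
        exact (eq_neg_of_add_eq_zero_left h2).symm
      rw [h1]
      exact M.nsmul_mem ha _ }

theorem GroupConeFace.mem_kunzSubgroup {G : Type*} [AddCommGroup G] [Finite G]
    (F : GroupConeFace G) (h : G) :
    h ∈ F.kunzSubgroup ↔ ∀ x ∈ F.carrier, coord x h = 0 := Iff.rfl

/-- The ground set `G/H` of the Kunz poset of `F`. -/
def KunzPoset {G : Type*} [AddCommGroup G] [Finite G] (F : GroupConeFace G) : Type _ :=
  G ⧸ F.kunzSubgroup

instance KunzPoset.instAddCommGroup {G : Type*} [AddCommGroup G] [Finite G]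
    (F : GroupConeFace G) : AddCommGroup (KunzPoset F) :=
  inferInstanceAs (AddCommGroup (G ⧸ F.kunzSubgroup))

instance KunzPoset.instFinite {G : Type*} [AddCommGroup G] [Finite G]
    (F : GroupConeFace G) : Finite (KunzPoset F) :=
  inferInstanceAs (Finite (G ⧸ F.kunzSubgroup))

/-- The class of `a` in `G/H`. -/
def KunzPoset.mk {G : Type*} [AddCommGroup G] [Finite G] (F : GroupConeFace G) :
    G →+ KunzPoset F :=
  QuotientAddGroup.mk' F.kunzSubgroup

theorem KunzPoset.mk_surjective {G : Type*} [AddCommGroup G] [Finite G]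
    (F : GroupConeFace G) : Function.Surjective (KunzPoset.mk F) :=
  QuotientAddGroup.mk'_surjective _

/-- Points of `F` are constant on cosets of `H`, so that `x ∈ F` has coordinates `x_p`
for `p ∈ G/H`, where `x_p = x_a` for every representative `a` of `p`. -/
def KunzPoset.coord {G : Type*} [AddCommGroup G] [Finite G] {F : GroupConeFace G}
    (x : F.carrier) : KunzPoset F → ℝ :=
  Quotient.lift (fun a : G => _root_.coord x.1 a) (by
    intro a b hab
    have hab' : -a + b ∈ F.kunzSubgroup := QuotientAddGroup.leftRel_apply.mp hab
    have hba : -b + a ∈ F.kunzSubgroup := by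
      have := F.kunzSubgroup.neg_mem hab'
      simpa using this
    have hx := F.mem_groupCone x.2
    have h1 := coord_add_le hx a (-a + b)
    have h2 := coord_add_le hx b (-b + a)
    rw [(F.mem_kunzSubgroup _).mp hab' x.1 x.2, add_neg_cancel_left, add_zero] at h1
    rw [(F.mem_kunzSubgroup _).mp hba x.1 x.2, add_neg_cancel_left, add_zero] at h2
    exact le_antisymm h2 h1)

theorem KunzPoset.coord_mk {G : Type*} [AddCommGroup G] [Finite G] {F : GroupConeFace G}
    (x : F.carrier) (a : G) : KunzPoset.coord x (KunzPoset.mk F a) = _root_.coord x.1 a := rfl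

theorem KunzPoset.coord_zero {G : Type*} [AddCommGroup G] [Finite G] {F : GroupConeFace G}
    (x : F.carrier) : KunzPoset.coord x 0 = 0 := by
  rw [← map_zero (KunzPoset.mk F), KunzPoset.coord_mk, _root_.coord_zero]

theorem KunzPoset.coord_nonneg {G : Type*} [AddCommGroup G] [Finite G] {F : GroupConeFace G}
    (x : F.carrier) (p : KunzPoset F) : 0 ≤ KunzPoset.coord x p := by
  obtain ⟨a, rfl⟩ := KunzPoset.mk_surjective F p
  exact _root_.coord_nonneg (F.mem_groupCone x.2) a

theorem KunzPoset.coord_add_le {G : Type*} [AddCommGroup G] [Finite G] {F : GroupConeFace G}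
    (x : F.carrier) (p q : KunzPoset F) :
    KunzPoset.coord x (p + q) ≤ KunzPoset.coord x p + KunzPoset.coord x q := by
  obtain ⟨a, rfl⟩ := KunzPoset.mk_surjective F p
  obtain ⟨b, rfl⟩ := KunzPoset.mk_surjective F q
  rw [← map_add]
  exact _root_.coord_add_le (F.mem_groupCone x.2) a b

theorem KunzPoset.eq_zero_of_coord {G : Type*} [AddCommGroup G] [Finite G]
    {F : GroupConeFace G} (p : KunzPoset F) (h : ∀ x : F.carrier, KunzPoset.coord x p = 0) :
    p = 0 := by
  obtain ⟨a, rfl⟩ := KunzPoset.mk_surjective F p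
  exact (QuotientAddGroup.eq_zero_iff a).mpr
    ((F.mem_kunzSubgroup a).mpr fun x hx => h ⟨x, hx⟩)

/-- The equation `x_p + x_q = x_{p+q}` holds for all `x ∈ F`. -/
def KunzPoset.Tight {G : Type*} [AddCommGroup G] [Finite G] {F : GroupConeFace G}
    (p q : KunzPoset F) : Prop :=
  ∀ x : F.carrier, KunzPoset.coord x p + KunzPoset.coord x q = KunzPoset.coord x (p + q)

/-- The Kunz poset `(G/H, ⪯)` of `F`: `p ⪯ q` if and only if `x_p + x_{q-p} = x_q` for all
`x ∈ F`. -/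
instance KunzPoset.instPartialOrder {G : Type*} [AddCommGroup G] [Finite G]
    (F : GroupConeFace G) : PartialOrder (KunzPoset F) where
  le p q := KunzPoset.Tight p (q - p)
  le_refl p x := by simp [KunzPoset.coord_zero]
  le_trans p q r hpq hqr x := by
    have h1 := hpq x
    have h2 := hqr x
    have h3 := KunzPoset.coord_add_le x (r - q) (q - p)
    have h4 := KunzPoset.coord_add_le x p (r - p)
    rw [add_sub_cancel] at h1 h2 h4 ⊢
    rw [sub_add_sub_cancel] at h3
    linarith
  le_antisymm p q hpq hqp := by
    have h0 : q - p = 0 := by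
      apply KunzPoset.eq_zero_of_coord
      intro x
      have h1 := hpq x
      have h2 := hqp x
      have h3 := KunzPoset.coord_nonneg x (q - p)
      have h4 := KunzPoset.coord_nonneg x (p - q)
      rw [add_sub_cancel] at h1 h2
      linarith
    exact (sub_eq_zero.mp h0).symm

/-- The underlying set `N = (G/H) ∪ {∞}` of the Kunz nilsemigroup of `F`. -/
inductive KunzNilsemigroup {G : Type*} [AddCommGroup G] [Finite G] (F : GroupConeFace G)
  | of (p : KunzPoset F) : KunzNilsemigroup F
  | infty : KunzNilsemigroup F

/-- The operation of the Kunz nilsemigroup: `∞` is nil, and `p ⊕ q` is `p + q` if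
`x_p + x_q = x_{p+q}` for all `x ∈ F`, and `∞` otherwise. -/
def KunzNilsemigroup.add {G : Type*} [AddCommGroup G] [Finite G] {F : GroupConeFace G} :
    KunzNilsemigroup F → KunzNilsemigroup F → KunzNilsemigroup F
  | .of p, .of q => open Classical in if KunzPoset.Tight p q then .of (p + q) else .infty
  | .of _, .infty => .infty
  | .infty, _ => .infty

theorem KunzPoset.tight_comm {G : Type*} [AddCommGroup G] [Finite G] {F : GroupConeFace G}
    (p q : KunzPoset F) : KunzPoset.Tight p q ↔ KunzPoset.Tight q p := by
  unfold KunzPoset.Tight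
  simp only [add_comm]

theorem KunzPoset.tight_assoc {G : Type*} [AddCommGroup G] [Finite G] {F : GroupConeFace G}
    (p q r : KunzPoset F) :
    (KunzPoset.Tight p q ∧ KunzPoset.Tight (p + q) r) ↔
      (KunzPoset.Tight q r ∧ KunzPoset.Tight p (q + r)) := by
  constructor
  · rintro ⟨h1, h2⟩
    refine ⟨fun x => ?_, fun x => ?_⟩ <;>
    · have e1 := h1 x
      have e2 := h2 x
      have e3 := KunzPoset.coord_add_le x q r
      have e4 := KunzPoset.coord_add_le x p (q + r)
      rw [← add_assoc] at e4
      try rw [← add_assoc]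
      linarith
  · rintro ⟨h1, h2⟩
    refine ⟨fun x => ?_, fun x => ?_⟩ <;>
    · have e1 := h1 x
      have e2 := h2 x
      have e3 := KunzPoset.coord_add_le x p q
      have e4 := KunzPoset.coord_add_le x (p + q) r
      rw [← add_assoc] at e2
      linarith

instance KunzNilsemigroup.instAdd {G : Type*} [AddCommGroup G] [Finite G]
    (F : GroupConeFace G) : Add (KunzNilsemigroup F) := ⟨KunzNilsemigroup.add⟩

instance KunzNilsemigroup.instZero {G : Type*} [AddCommGroup G] [Finite G]
    (F : GroupConeFace G) : Zero (KunzNilsemigroup F) := ⟨.of 0⟩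

instance KunzNilsemigroup.instAddCommMonoid {G : Type*} [AddCommGroup G] [Finite G]
    (F : GroupConeFace G) : AddCommMonoid (KunzNilsemigroup F) where
  add_comm a b := by
    change KunzNilsemigroup.add a b = KunzNilsemigroup.add b a
    cases a <;> cases b <;>
      simp only [KunzNilsemigroup.add, KunzPoset.tight_comm, add_comm]
    next p q => rw [KunzPoset.tight_comm]
  add_assoc a b c := by
    change KunzNilsemigroup.add (KunzNilsemigroup.add a b) c =
      KunzNilsemigroup.add a (KunzNilsemigroup.add b c)
    cases a with
    | infty => rfl
    | of p =>
      cases b with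
      | infty => rfl
      | of q =>
        cases c with
        | infty =>
          simp only [KunzNilsemigroup.add]
          split_ifs <;> rfl
        | of r =>
          have h := KunzPoset.tight_assoc p q r
          by_cases h1 : KunzPoset.Tight p q <;> by_cases h2 : KunzPoset.Tight q r <;>
            by_cases h3 : KunzPoset.Tight (p + q) r <;>
            by_cases h4 : KunzPoset.Tight p (q + r) <;>
            simp_all [KunzNilsemigroup.add, add_assoc]
  zero_add a := by
    change KunzNilsemigroup.add (.of 0) a = a
    cases a with
    | infty => rfl
    | of p =>
      have : KunzPoset.Tight 0 p := fun x => by simp [KunzPoset.coord_zero]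
      simp [KunzNilsemigroup.add, this]
  add_zero a := by
    change KunzNilsemigroup.add a (.of 0) = a
    cases a with
    | infty => rfl
    | of p =>
      have : KunzPoset.Tight p 0 := fun x => by simp [KunzPoset.coord_zero]
      simp [KunzNilsemigroup.add, this]
  nsmul := nsmulRec

/-- The atoms of the Kunz poset: the elements that cover its minimal element `0`. -/
def KunzPoset.Atom {G : Type*} [AddCommGroup G] [Finite G] (F : GroupConeFace G) : Type _ :=
  {p : KunzPoset F // 0 ⋖ p}

instance KunzPoset.Atom.instFintype {G : Type*} [AddCommGroup G] [Finite G]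
    (F : GroupConeFace G) : Fintype (KunzPoset.Atom F) :=
  haveI : Finite (KunzPoset.Atom F) := Subtype.finite
  Fintype.ofFinite _

/-- The factorization homomorphism `φ_P : ℕ^k → P ∪ {∞}`, `z ↦ z_1 p_1 ⊕ ⋯ ⊕ z_k p_k`, with
coordinates indexed by the atoms `p_1, …, p_k`. -/
def KunzPoset.factorizationHom {G : Type*} [AddCommGroup G] [Finite G]
    (F : GroupConeFace G) : (KunzPoset.Atom F → ℕ) →+ KunzNilsemigroup F where
  toFun z := ∑ p, z p • KunzNilsemigroup.of p.1
  map_zero' := by simp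
  map_add' z w := by simp [add_smul, Finset.sum_add_distrib]

/-- `ρ` is a presentation of the Kunz poset `P`: it is obtained from a set `σ` of generators of
the congruence `ker φ_P` by omitting the generators `(z, z')` with `φ_P(z) = ∞`. -/
def KunzPoset.IsPresentation {G : Type*} [AddCommGroup G] [Finite G] (F : GroupConeFace G)
    (ρ : Set ((KunzPoset.Atom F → ℕ) × (KunzPoset.Atom F → ℕ))) : Prop :=
  ∃ σ : Set ((KunzPoset.Atom F → ℕ) × (KunzPoset.Atom F → ℕ)),
    addConGen (fun z z' => (z, z') ∈ σ) = AddCon.ker (KunzPoset.factorizationHom F) ∧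
    ρ = {t ∈ σ | KunzPoset.factorizationHom F t.1 ≠ KunzNilsemigroup.infty}

/-- The presentation matrix `M_ρ`: columns indexed by the atoms, and one row `z - z'` for each
`(z, z') ∈ ρ`. -/
def presentationMatrix {A : Type*} (ρ : Finset ((A → ℕ) × (A → ℕ))) : Matrix ρ A ℤ :=
  fun t p => (t.1.1 p : ℤ) - (t.1.2 p : ℤ)

end

/-! Translating by the vertex turns `F` into a face `F'` of the cone, and `dim F` is the dimension
of the linear span of `F'`. That span is computed twice.

Geometrically, it is the space of functions on `P` that are additive on tight pairs
(`map_pullback_tightFunctions`): points of `F'` are such functions, and conversely a small multiple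
of any such function can be added to a relative interior point without leaving the face.

Combinatorially, a tight function is determined by its values on atoms, since atoms generate the
elements of `P` in the nilsemigroup. Values `w` on the atoms extend exactly when all factorizations
of an element have equal `w`-weight, and it suffices to test this on a presentation
(`IsPresentation.weight_eq`). So the space is the kernel of `M_ρ`
(`map_restrictAtoms_tightFunctions`), and rank-nullity finishes. -/

theorem coord_add {G : Type*} [AddCommGroup G] (x y : {g : G // g ≠ 0} → ℝ) (a : G) :
    coord (x + y) a = coord x a + coord y a := by
  unfold coord; split_ifs <;> simp

theorem coord_smul {G : Type*} [AddCommGroup G] (c : ℝ) (x : {g : G // g ≠ 0} → ℝ) (a : G) :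
    coord (c • x) a = c * coord x a := by
  unfold coord; split_ifs <;> simp

theorem coord_sum {G ι : Type*} [AddCommGroup G] (s : Finset ι)
    (x : ι → {g : G // g ≠ 0} → ℝ) (a : G) :
    coord (∑ i ∈ s, x i) a = ∑ i ∈ s, coord (x i) a := by
  unfold coord; split_ifs <;> simp

theorem zero_mem_groupCone (G : Type*) [AddCommGroup G] :
    (0 : {g : G // g ≠ 0} → ℝ) ∈ groupCone G :=
  ⟨fun _ => le_rfl, fun _ _ _ => by simp⟩

/-- On a finite group, subadditivity of the coordinates forces nonnegativity. -/
theorem mem_groupCone_of_subadditive {G : Type*} [AddCommGroup G] [Finite G]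
    {x : {g : G // g ≠ 0} → ℝ} (h : ∀ a b, coord x (a + b) ≤ coord x a + coord x b) :
    x ∈ groupCone G := by
  -- Taking `n` to be the order of `a` gives `0 ≤ n * x_a`, which is where finiteness enters.
  have hn : ∀ (n : ℕ) (a : G), coord x (n • a) ≤ n * coord x a := by
    intro n a
    induction n with
    | zero => simp [coord_zero]
    | succ n ih =>
      rw [succ_nsmul]
      push_cast
      linarith [h (n • a) a]
  refine ⟨fun i => ?_, fun i j hij => ?_⟩
  · have h1 := hn (addOrderOf i.1) i.1
    rw [addOrderOf_nsmul_eq_zero, coord_zero, coord_coe] at h1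
    exact nonneg_of_mul_nonneg_right h1 (by exact_mod_cast addOrderOf_pos i.1)
  · have h1 := h i.1 j.1
    rwa [coord_coe, coord_coe, coord_coe x ⟨_, hij⟩] at h1

theorem mem_groupCone_iff_subadditive {G : Type*} [AddCommGroup G] [Finite G]
    {x : {g : G // g ≠ 0} → ℝ} :
    x ∈ groupCone G ↔ ∀ a b, coord x (a + b) ≤ coord x a + coord x b :=
  ⟨coord_add_le, mem_groupCone_of_subadditive⟩

theorem smul_mem_groupCone {G : Type*} [AddCommGroup G] [Finite G]
    {x : {g : G // g ≠ 0} → ℝ} (hx : x ∈ groupCone G) {c : ℝ} (hc : 0 ≤ c) :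
    c • x ∈ groupCone G := by
  rw [mem_groupCone_iff_subadditive] at hx ⊢
  intro a b
  simp only [coord_smul]
  rw [← mul_add]
  exact mul_le_mul_of_nonneg_left (hx a b) hc

theorem add_mem_groupCone {G : Type*} [AddCommGroup G] [Finite G]
    {x y : {g : G // g ≠ 0} → ℝ} (hx : x ∈ groupCone G) (hy : y ∈ groupCone G) :
    x + y ∈ groupCone G := by
  rw [mem_groupCone_iff_subadditive] at hx hy ⊢
  intro a b
  simp only [coord_add]
  linarith [hx a b, hy a b]

/-! ### Faces of the group cone and their linear spans -/

namespace GroupConeFace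

variable {G : Type*} [AddCommGroup G] [Finite G] (F : GroupConeFace G)

/-- A face of the group cone is cut out by a linear functional that is nonpositive on the cone. -/
theorem exists_functional : ∃ l : StrongDual ℝ ({g : G // g ≠ 0} → ℝ),
    (∀ x ∈ groupCone G, l x ≤ 0) ∧ ∀ x, x ∈ F.carrier ↔ x ∈ groupCone G ∧ l x = 0 := by
  obtain ⟨⟨x₀, hx₀⟩, hexp⟩ := F.isFace
  obtain ⟨l, hl⟩ := hexp ⟨x₀, hx₀⟩
  have hx₀' := hx₀
  rw [hl] at hx₀'
  obtain ⟨hc, hmax⟩ := hx₀'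
  have h0 : l x₀ = 0 := by
    -- The cone contains `0` and `2 x₀`, so a maximum attained at `x₀` must be `0`.
    have h1 := hmax 0 (zero_mem_groupCone G)
    have h2 := hmax ((2 : ℝ) • x₀) (smul_mem_groupCone hc (by norm_num))
    rw [map_zero] at h1
    rw [map_smul, smul_eq_mul] at h2
    linarith
  refine ⟨l, fun x hx => h0 ▸ hmax x hx, fun x => ?_⟩
  rw [hl]
  refine and_congr_right fun hx => ⟨fun h => ?_, fun h y hy => ?_⟩
  · exact le_antisymm (h0 ▸ hmax x hx) (h0 ▸ h x₀ hc)
  · rw [h, ← h0]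
    exact hmax y hy

/-- The points of a face form a submonoid. -/
theorem exists_addSubmonoid :
    ∃ S : AddSubmonoid ({g : G // g ≠ 0} → ℝ), (S : Set _) = F.carrier := by
  obtain ⟨l, -, hF⟩ := F.exists_functional
  refine ⟨{ carrier := F.carrier, zero_mem' := ?_, add_mem' := ?_ }, rfl⟩
  · intro a b ha hb
    rw [hF] at ha hb ⊢
    exact ⟨add_mem_groupCone ha.1 hb.1, by rw [map_add, ha.2, hb.2, add_zero]⟩
  · rw [hF]
    exact ⟨zero_mem_groupCone G, map_zero l⟩

theorem zero_mem : 0 ∈ F.carrier := by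
  obtain ⟨S, hS⟩ := F.exists_addSubmonoid
  exact hS ▸ S.zero_mem

/-- A face has a point at which every inequality that is not tight on the face is strict. -/
theorem exists_relative_interior_point : ∃ x ∈ F.carrier, ∀ a b : G,
    ¬ KunzPoset.Tight (KunzPoset.mk F a) (KunzPoset.mk F b) →
      coord x (a + b) < coord x a + coord x b := by
  classical
  have := Fintype.ofFinite G
  have hw : ∀ t : G × G, ∃ x ∈ F.carrier,
      ¬ KunzPoset.Tight (KunzPoset.mk F t.1) (KunzPoset.mk F t.2) →
        coord x (t.1 + t.2) < coord x t.1 + coord x t.2 := by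
    rintro ⟨a, b⟩
    by_cases h : KunzPoset.Tight (KunzPoset.mk F a) (KunzPoset.mk F b)
    · exact ⟨0, F.zero_mem, fun h' => absurd h h'⟩
    · unfold KunzPoset.Tight at h
      push Not at h
      obtain ⟨x, hx⟩ := h
      rw [← map_add, KunzPoset.coord_mk, KunzPoset.coord_mk, KunzPoset.coord_mk] at hx
      exact ⟨x.1, x.2, fun _ => lt_of_le_of_ne (_root_.coord_add_le (F.mem_groupCone x.2) a b)
        hx.symm⟩
  choose x hx hxt using hw
  obtain ⟨S, hS⟩ := F.exists_addSubmonoid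
  -- In the sum of one witness per pair, each summand satisfies every inequality weakly, and the
  -- witness for `(a, b)` makes that one strict.
  refine ⟨∑ t, x t, ?_, fun a b hab => ?_⟩
  · rw [← hS]
    exact S.sum_mem fun t _ => by
      have := hx t
      rwa [← hS] at this
  · rw [coord_sum, coord_sum, coord_sum, ← Finset.sum_add_distrib]
    exact Finset.sum_lt_sum (fun t _ => _root_.coord_add_le (F.mem_groupCone (hx t)) a b)
      ⟨(a, b), Finset.mem_univ _, hxt (a, b) hab⟩

/-- The real functions on the Kunz poset of `F` that are additive on tight pairs. -/
def tightFunctions : Submodule ℝ (KunzPoset F → ℝ) where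
  carrier := {f | ∀ p q, KunzPoset.Tight p q → f p + f q = f (p + q)}
  zero_mem' := fun _ _ _ => by simp
  add_mem' := by
    intro f g hf hg p q h
    simp only [Pi.add_apply, ← hf p q h, ← hg p q h]
    ring
  smul_mem' := by
    intro c f hf p q h
    simp only [Pi.smul_apply, smul_eq_mul, ← hf p q h]
    ring

variable {F} in
theorem apply_zero_of_mem_tightFunctions {f : KunzPoset F → ℝ} (hf : f ∈ F.tightFunctions) :
    f 0 = 0 := by
  have := hf 0 0 fun x => by simp [KunzPoset.coord_zero]
  simpa using this

/-- Pullback of functions on the Kunz poset to the ambient space of the group cone. -/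
def pullback : (KunzPoset F → ℝ) →ₗ[ℝ] ({g : G // g ≠ 0} → ℝ) :=
  LinearMap.funLeft ℝ ℝ fun g => KunzPoset.mk F g.1

variable {F} in
theorem coord_pullback {f : KunzPoset F → ℝ} (hf : f ∈ F.tightFunctions) (a : G) :
    coord (F.pullback f) a = f (KunzPoset.mk F a) := by
  unfold coord
  split_ifs with h
  · rw [h, map_zero, apply_zero_of_mem_tightFunctions hf]
  · rfl

variable {F} in
/-- A tight function, pulled back, moves a relative interior point inside the group cone. -/
theorem exists_add_smul_pullback_mem {x : {g : G // g ≠ 0} → ℝ} (hx : x ∈ F.carrier)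
    (hlt : ∀ a b : G, ¬ KunzPoset.Tight (KunzPoset.mk F a) (KunzPoset.mk F b) →
      coord x (a + b) < coord x a + coord x b)
    {f : KunzPoset F → ℝ} (hf : f ∈ F.tightFunctions) :
    ∃ ε : ℝ, 0 < ε ∧ x + ε • F.pullback f ∈ groupCone G ∧
      x + (-ε) • F.pullback f ∈ groupCone G := by
  have key : ∀ a b : G, ∀ᶠ ε : ℝ in nhds 0,
      coord (x + ε • F.pullback f) (a + b) ≤
        coord (x + ε • F.pullback f) a + coord (x + ε • F.pullback f) b := by
    intro a b
    simp only [coord_add, coord_smul]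
    -- On a tight pair the perturbation is additive, so any `ε` works; a strict inequality survives
    -- small `ε` by continuity. There are only finitely many pairs.
    by_cases h : KunzPoset.Tight (KunzPoset.mk F a) (KunzPoset.mk F b)
    · refine Filter.Eventually.of_forall fun ε => ?_
      have h1 := hf _ _ h
      rw [coord_pullback hf, coord_pullback hf, coord_pullback hf, map_add, ← h1]
      linarith [_root_.coord_add_le (F.mem_groupCone hx) a b]
    · have hL : Continuous fun ε : ℝ =>
          coord x (a + b) + ε * coord (F.pullback f) (a + b) := by fun_prop
      have hR : Continuous fun ε : ℝ => coord x a + ε * coord (F.pullback f) a +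
          (coord x b + ε * coord (F.pullback f) b) := by fun_prop
      refine (hL.continuousAt.eventually_lt hR.continuousAt ?_).mono fun _ h => h.le
      simpa using hlt a b h
  have hall : ∀ᶠ ε : ℝ in nhds 0, x + ε • F.pullback f ∈ groupCone G := by
    simp only [mem_groupCone_iff_subadditive]
    exact Filter.eventually_all.2 fun a => Filter.eventually_all.2 fun b => key a b
  obtain ⟨δ, hδ, hball⟩ := Metric.eventually_nhds_iff.1 hall
  have hpos : 0 < δ / 2 := half_pos hδ
  have habs : |δ| / 2 < δ := by rw [abs_of_pos hδ]; linarith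
  exact ⟨δ / 2, hpos, hball (by simpa using habs), hball (by simpa using habs)⟩

/-- A functional that is nonpositive on the cone and zero at an interior point of a segment in the
cone vanishes on the whole segment, so perturbing in both directions stays in the face. -/
theorem map_pullback_tightFunctions :
    F.tightFunctions.map F.pullback = Submodule.span ℝ F.carrier := by
  apply le_antisymm
  · rintro _ ⟨f, hf, rfl⟩
    obtain ⟨l, hl, hF⟩ := F.exists_functional
    obtain ⟨x, hx, hlt⟩ := F.exists_relative_interior_point
    obtain ⟨ε, hε, h1, h2⟩ := exists_add_smul_pullback_mem hx hlt hf
    have hlx := ((hF x).1 hx).2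
    have hmem : x + ε • F.pullback f ∈ F.carrier := by
      refine (hF _).2 ⟨h1, ?_⟩
      have e1 := hl _ h1
      have e2 := hl _ h2
      rw [map_add, map_smul, smul_eq_mul, hlx] at e1 e2 ⊢
      linarith
    have h3 : F.pullback f = ε⁻¹ • ((x + ε • F.pullback f) - x) := by
      rw [add_sub_cancel_left, smul_smul, inv_mul_cancel₀ hε.ne', one_smul]
    rw [h3]
    exact Submodule.smul_mem _ _ (Submodule.sub_mem _ (Submodule.subset_span hmem)
      (Submodule.subset_span hx))
  · rw [Submodule.span_le]
    intro x hx
    refine ⟨KunzPoset.coord ⟨x, hx⟩, fun p q h => h ⟨x, hx⟩, ?_⟩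
    ext g
    exact coord_coe x g

/-- Pullback forgets only the coordinate at `0`, where tight functions vanish, so it is injective on
them. -/
theorem finrank_span_carrier :
    Module.finrank ℝ (Submodule.span ℝ F.carrier) = Module.finrank ℝ F.tightFunctions := by
  have hinj : Function.Injective (F.pullback ∘ₗ F.tightFunctions.subtype) := by
    rw [← LinearMap.ker_eq_bot, LinearMap.ker_eq_bot']
    rintro ⟨f, hf⟩ h
    have h' : F.pullback f = 0 := h
    ext p
    obtain ⟨a, rfl⟩ := KunzPoset.mk_surjective F p
    change f (KunzPoset.mk F a) = 0
    rw [← coord_pullback hf, h']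
    unfold coord
    split_ifs <;> rfl
  rw [← F.map_pullback_tightFunctions, ← LinearMap.finrank_range_of_inj hinj,
    LinearMap.range_comp, Submodule.range_subtype]

end GroupConeFace

/-- The vertex lies on every face, so it can serve as base point of the affine span. -/
theorem faceDim_eq_finrank_span_of_ofKunz {m : ℕ} [NeZero m]
    {F : Set ({a : ZMod m // a ≠ 0} → ℝ)} (hF : IsPolyhedronFace (kunzPolyhedron m) F) :
    faceDim F = Module.finrank ℝ (Submodule.span ℝ (GroupConeFace.ofKunz F hF).carrier) := by
  have hv : kunzVertex m ∈ F := by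
    have h : (0 : {a : ZMod m // a ≠ 0} → ℝ) + kunzVertex m ∈ F :=
      (GroupConeFace.ofKunz F hF).zero_mem
    rwa [zero_add] at h
  have himage : (· -ᵥ kunzVertex m) '' F = (GroupConeFace.ofKunz F hF).carrier := by
    ext y
    constructor
    · rintro ⟨x, hx, rfl⟩
      change x - kunzVertex m + kunzVertex m ∈ F
      rwa [sub_add_cancel]
    · intro hy
      exact ⟨y + kunzVertex m, hy, add_sub_cancel_right y _⟩
  rw [faceDim, direction_affineSpan, vectorSpan_eq_span_vsub_set_right ℝ hv, himage]

theorem KunzPoset.zero_le {G : Type*} [AddCommGroup G] [Finite G] {F : GroupConeFace G}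
    (p : KunzPoset F) : 0 ≤ p :=
  fun x => by simp [KunzPoset.coord_zero]

/-! ### Finite sums in the nilsemigroup -/

namespace KunzNilsemigroup

variable {G : Type*} [AddCommGroup G] [Finite G] {F : GroupConeFace G}

theorem of_zero : (of 0 : KunzNilsemigroup F) = 0 := rfl

theorem of_add_of {p q : KunzPoset F} (h : KunzPoset.Tight p q) :
    of p + of q = of (p + q) :=
  if_pos h

theorem eq_of_of_add_eq_of {n n' : KunzNilsemigroup F} {r : KunzPoset F}
    (h : n + n' = of r) :
    ∃ p q, n = of p ∧ n' = of q ∧ KunzPoset.Tight p q ∧ p + q = r := by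
  change add n n' = of r at h
  cases n with
  | infty => cases h
  | of p =>
    cases n' with
    | infty => cases h
    | of q =>
      simp only [add] at h
      split_ifs at h with ht
      cases h
      exact ⟨p, q, rfl, rfl, ht, rfl⟩

theorem ne_infty_iff {n : KunzNilsemigroup F} : n ≠ infty ↔ ∃ p, n = of p := by
  cases n <;> simp

end KunzNilsemigroup

/-! ### Factorizations into atoms and the presentation matrix -/

namespace KunzPoset

variable {G : Type*} [AddCommGroup G] [Finite G] {F : GroupConeFace G}

theorem factorizationHom_single [DecidableEq (Atom F)] (i : Atom F) :
    factorizationHom F (Pi.single i 1) = KunzNilsemigroup.of i.1 := by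
  change ∑ j, (Pi.single i 1 : Atom F → ℕ) j • KunzNilsemigroup.of j.1 = _
  rw [Finset.sum_eq_single i (fun j _ hj => by rw [Pi.single_eq_of_ne hj, zero_nsmul])
    (fun h => absurd (Finset.mem_univ i) h), Pi.single_eq_same, one_nsmul]

/-- Every element of the Kunz poset is a sum of atoms in the Kunz nilsemigroup. -/
theorem exists_factorizationHom_eq (q : KunzPoset F) :
    ∃ z, factorizationHom F z = KunzNilsemigroup.of q := by
  classical
  have : WellFoundedLT (KunzPoset F) := inferInstance
  induction q using WellFoundedLT.induction with
  | ind q ih =>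
    rcases (KunzPoset.zero_le q).eq_or_lt with h0 | h0
    · exact ⟨0, by rw [map_zero, ← h0, KunzNilsemigroup.of_zero]⟩
    · obtain ⟨p, hp, hpq⟩ := exists_covBy_le_of_lt h0
      -- Split off an atom `p` below `q`; the remainder `q - p` is strictly smaller because `p ≠ 0`.
      have ht : Tight p (q - p) := hpq
      have hle : q - p ≤ q := by
        change Tight (q - p) (q - (q - p))
        rw [sub_sub_cancel]
        exact (tight_comm _ _).1 ht
      have hne : q - p ≠ q := fun h => hp.ne' (sub_eq_self.1 h)
      obtain ⟨z, hz⟩ := ih _ (lt_of_le_of_ne hle hne)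
      let i : Atom F := ⟨p, hp⟩
      refine ⟨Pi.single i 1 + z, ?_⟩
      rw [map_add, factorizationHom_single, hz, KunzNilsemigroup.of_add_of ht, add_sub_cancel]

/-- A tight function is determined by its values on atoms through factorizations. -/
theorem sum_mul_apply_atom {f : KunzPoset F → ℝ} (hf : f ∈ F.tightFunctions)
    {z : Atom F → ℕ} {q : KunzPoset F} (hz : factorizationHom F z = KunzNilsemigroup.of q) :
    ∑ i, (z i : ℝ) * f i.1 = f q := by
  -- The graph of `f`, with any real allowed over `∞`; it is closed under addition because a finite
  -- sum has finite summands forming a tight pair.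
  let S : AddSubmonoid (KunzNilsemigroup F × ℝ) :=
    { carrier := {t | ∀ q, t.1 = KunzNilsemigroup.of q → t.2 = f q}
      zero_mem' := by
        intro q hq
        cases hq
        exact (GroupConeFace.apply_zero_of_mem_tightFunctions hf).symm
      add_mem' := by
        intro s t hs ht r hr
        obtain ⟨p, q, hp, hq, hpq, rfl⟩ := KunzNilsemigroup.eq_of_of_add_eq_of hr
        rw [Prod.snd_add, hs p hp, ht q hq, hf p q hpq] }
  have hmem : ∑ i, z i • ((KunzNilsemigroup.of i.1, f i.1) : KunzNilsemigroup F × ℝ) ∈ S := by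
    refine S.sum_mem fun i _ => S.nsmul_mem ?_ _
    intro q hq
    cases hq
    rfl
  have h := hmem q (by rw [Prod.fst_sum]; exact hz)
  rw [Prod.snd_sum] at h
  simpa using h

/-- Additive weights that agree on the pairs of a presentation agree on all factorizations of the
same element. -/
theorem IsPresentation.weight_eq
    {ρ : Set ((Atom F → ℕ) × (Atom F → ℕ))} (hρ : IsPresentation F ρ)
    (w : (Atom F → ℕ) →+ ℝ) (hw : ∀ t ∈ ρ, w t.1 = w t.2) {z z' : Atom F → ℕ}
    {q : KunzPoset F} (hz : factorizationHom F z = KunzNilsemigroup.of q)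
    (hz' : factorizationHom F z' = KunzNilsemigroup.of q) : w z = w z' := by
  obtain ⟨σ, hσ, rfl⟩ := hρ
  -- Weights are left unconstrained over `∞`, so the generators omitted from `ρ` also lie in this
  -- congruence, and hence so does the whole kernel.
  let c : AddCon (Atom F → ℕ) :=
    { r := fun z z' => factorizationHom F z = factorizationHom F z' ∧
        (factorizationHom F z ≠ KunzNilsemigroup.infty → w z = w z')
      iseqv :=
        { refl := fun z => ⟨rfl, fun _ => rfl⟩
          symm := fun h => ⟨h.1.symm, fun h' => (h.2 (h.1 ▸ h')).symm⟩
          trans := fun h k => ⟨h.1.trans k.1, fun h' => (h.2 h').trans (k.2 (h.1 ▸ h'))⟩ }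
      add' := by
        intro a b a' b' h k
        refine ⟨by rw [map_add, map_add, h.1, k.1], fun hne => ?_⟩
        rw [map_add, KunzNilsemigroup.ne_infty_iff] at hne
        obtain ⟨r, hr⟩ := hne
        obtain ⟨p, q, hp, hq, -, -⟩ := KunzNilsemigroup.eq_of_of_add_eq_of hr
        rw [map_add, map_add, h.2 (KunzNilsemigroup.ne_infty_iff.2 ⟨p, hp⟩),
          k.2 (KunzNilsemigroup.ne_infty_iff.2 ⟨q, hq⟩)] }
  have hle : AddCon.ker (factorizationHom F) ≤ c := by
    rw [← hσ, AddCon.addConGen_le]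
    intro a b hab
    have hker : AddCon.ker (factorizationHom F) a b := hσ ▸ AddConGen.Rel.of a b hab
    exact ⟨hker, fun hne => hw (a, b) ⟨hab, hne⟩⟩
  have hzz' : AddCon.ker (factorizationHom F) z z' := hz.trans hz'.symm
  exact (hle hzz').2 (KunzNilsemigroup.ne_infty_iff.2 ⟨q, hz⟩)

/-- Restriction of functions on the Kunz poset to its atoms. -/
def restrictAtoms (F : GroupConeFace G) : (KunzPoset F → ℝ) →ₗ[ℝ] (Atom F → ℝ) :=
  LinearMap.funLeft ℝ ℝ Subtype.val

theorem mem_ker_presentationMatrix {A : Type*} [Fintype A]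
    {ρ : Finset ((A → ℕ) × (A → ℕ))} {w : A → ℝ} :
    w ∈ LinearMap.ker ((presentationMatrix ρ).map (Int.cast : ℤ → ℝ)).mulVecLin ↔
      ∀ t ∈ ρ, ∑ i, (t.1 i : ℝ) * w i = ∑ i, (t.2 i : ℝ) * w i := by
  rw [LinearMap.mem_ker, Matrix.mulVecLin_apply, funext_iff, Subtype.forall]
  refine forall₂_congr fun t ht => ?_
  simp only [Matrix.mulVec, dotProduct, Matrix.map_apply, presentationMatrix, Int.cast_sub,
    Int.cast_natCast, sub_mul, Finset.sum_sub_distrib, Pi.zero_apply, sub_eq_zero]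

/-- A kernel vector extends to `P` by the weight of any chosen factorization; independence of the
choice gives both additivity on tight pairs and the prescribed values on atoms. -/
theorem map_restrictAtoms_tightFunctions {ρ : Finset ((Atom F → ℕ) × (Atom F → ℕ))}
    (hρ : IsPresentation F (ρ : Set _)) :
    F.tightFunctions.map (restrictAtoms F) =
      LinearMap.ker ((presentationMatrix ρ).map (Int.cast : ℤ → ℝ)).mulVecLin := by
  ext w
  rw [mem_ker_presentationMatrix]
  constructor
  · rintro ⟨f, hf, rfl⟩ t ht
    obtain ⟨σ, hσ, hρσ⟩ := hρ
    have ht' : t ∈ (ρ : Set _) := ht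
    rw [hρσ] at ht'
    obtain ⟨hts, hne⟩ := ht'
    obtain ⟨q, hq⟩ := KunzNilsemigroup.ne_infty_iff.1 hne
    have hker : AddCon.ker (factorizationHom F) t.1 t.2 := hσ ▸ AddConGen.Rel.of t.1 t.2 hts
    have hq' : factorizationHom F t.2 = KunzNilsemigroup.of q := Eq.trans (Eq.symm hker) hq
    exact (sum_mul_apply_atom hf hq).trans (sum_mul_apply_atom hf hq').symm
  · intro hw
    let W : (Atom F → ℕ) →+ ℝ :=
      { toFun := fun z => ∑ i, (z i : ℝ) * w i
        map_zero' := by simp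
        map_add' := fun z z' => by simp [add_mul, Finset.sum_add_distrib] }
    have hW : ∀ {z z' q}, factorizationHom F z = KunzNilsemigroup.of q →
        factorizationHom F z' = KunzNilsemigroup.of q → W z = W z' :=
      fun hz hz' => hρ.weight_eq W hw hz hz'
    choose z hz using exists_factorizationHom_eq (F := F)
    refine ⟨fun q => W (z q), fun p q h => ?_, ?_⟩
    · rw [← map_add]
      refine hW ?_ (hz (p + q))
      rw [map_add, hz, hz, KunzNilsemigroup.of_add_of h]
    · classical
      ext i
      change W (z i.1) = w i
      rw [hW (hz i.1) (factorizationHom_single i)]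
      change ∑ j, ((Pi.single i 1 : Atom F → ℕ) j : ℝ) * w j = w i
      simp [Pi.single_apply]

/-- Restriction is injective here: every element of `P` has a factorization, so a tight function
vanishing on atoms is zero. -/
theorem finrank_tightFunctions_eq_finrank_ker {ρ : Finset ((Atom F → ℕ) × (Atom F → ℕ))}
    (hρ : IsPresentation F (ρ : Set _)) :
    Module.finrank ℝ F.tightFunctions = Module.finrank ℝ
      (LinearMap.ker ((presentationMatrix ρ).map (Int.cast : ℤ → ℝ)).mulVecLin) := by
  have hinj : Function.Injective (restrictAtoms F ∘ₗ F.tightFunctions.subtype) := by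
    rw [← LinearMap.ker_eq_bot, LinearMap.ker_eq_bot']
    rintro ⟨f, hf⟩ h
    ext q
    obtain ⟨z, hz⟩ := exists_factorizationHom_eq q
    change f q = 0
    rw [← sum_mul_apply_atom hf hz]
    refine Finset.sum_eq_zero fun i _ => ?_
    have hi : f i.1 = 0 := congrFun h i
    rw [hi, mul_zero]
  rw [← map_restrictAtoms_tightFunctions hρ, ← LinearMap.finrank_range_of_inj hinj,
    LinearMap.range_comp, Submodule.range_subtype]

end KunzPoset

theorem theorem4p3 (m : ℕ) [NeZero m] (hm : 2 ≤ m)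
    (F : Set ({a : ZMod m // a ≠ 0} → ℝ)) (hF : IsPolyhedronFace (kunzPolyhedron m) F)
    (ρ : Finset ((KunzPoset.Atom (GroupConeFace.ofKunz F hF) → ℕ) ×
      (KunzPoset.Atom (GroupConeFace.ofKunz F hF) → ℕ)))
    (hρ : KunzPoset.IsPresentation (GroupConeFace.ofKunz F hF) (ρ : Set _)) :
    (faceDim F : ℤ) = (Fintype.card (KunzPoset.Atom (GroupConeFace.ofKunz F hF)) : ℤ) -
      (((presentationMatrix ρ).map (Int.cast : ℤ → ℝ)).rank : ℤ) := by
  rw [faceDim_eq_finrank_span_of_ofKunz hF, GroupConeFace.finrank_span_carrier,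
    KunzPoset.finrank_tightFunctions_eq_finrank_ker hρ]
  have h := LinearMap.finrank_range_add_finrank_ker
    ((presentationMatrix ρ).map (Int.cast : ℤ → ℝ)).mulVecLin
  rw [Module.finrank_fintype_fun_eq_card] at h
  rw [Matrix.rank]
  omega
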